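/- For a finite simple graph $G=(V,E)$ and a map $\mathbf p:V\to\mathbb R^d$, the rigidity matrix $\mathsf R(G,\mathbf p)\in\mathbb R^{E\times(V\times[d])}$ is the matrix whose row indexed by an edge $\{u,v\}\in E$ equals $\mathbf p(u)-\mathbf p(v)$ on the $d$ coordinates of $u$, equals $\mathbf p(v)-\mathbf p(u)$ on the $d$ coordinates of $v$, and is $0$ elsewhere. The graph $G$ is called $d$-rigid if $|V|\ge d+1$ and there is a map $\mathbf p:V\to\mathbb R^d$ with $\operatorname{rank}\mathsf R(G,\mathbf p)=d|V|-\binom{d+1}{2}$. **Theorem.** There exists a constant $c>0$ such that for all integers $n\ge 2$ and $d$ with $0\le d<c\sqrt n/\log n$ (natural logarithm), every $n$-vertex graph $G$ with minimum degree $\delta(G)\ge \frac n2+d$ is $(d+1)$-rigid. -/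

import Mathlib

/-- The rigidity matrix of the framework `(G, p)` in `ℝ^d`: rows are indexed by the edges of `G`,
columns by pairs (vertex, coordinate). The row of the edge `{u, v}` equals `p u - p v` on the
coordinates of `u`, `p v - p u` on the coordinates of `v`, and `0` elsewhere. -/
noncomputable def SimpleGraph.rigidityMatrix {V : Type*} (G : SimpleGraph V) {d : ℕ}
    (p : V → Fin d → ℝ) : Matrix G.edgeSet (V × Fin d) ℝ :=
  open Classical in
  Matrix.of fun e x =>
    if h : x.1 ∈ (e : Sym2 V) then p x.1 x.2 - p (Sym2.Mem.other h) x.2 else 0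

/-- The framework `(G, p)` is infinitesimally rigid: the rank of its rigidity matrix is exactly
`d |V| - (d+1 choose 2)` (written additively, so that no subtraction of naturals occurs). -/
def SimpleGraph.InfinitesimallyRigid {V : Type*} [Fintype V] (G : SimpleGraph V) {d : ℕ}
    (p : V → Fin d → ℝ) : Prop :=
  (G.rigidityMatrix p).rank + (d + 1).choose 2 = d * Fintype.card V

/-- `G` is rigid in `ℝ^d`: it has at least `d + 1` vertices and some placement `p` of its vertices
in `ℝ^d` makes `(G, p)` infinitesimally rigid. -/
def SimpleGraph.IsRigid {V : Type*} [Fintype V] (G : SimpleGraph V) (d : ℕ) : Prop :=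
  d + 1 ≤ Fintype.card V ∧ ∃ p : V → Fin d → ℝ, G.InfinitesimallyRigid p

/-! Put `D = d + 1` and fix a placement `p` in `ℝ^D` that maximises the rank of every set of pairs
at once. Let `H` be the closure of `G`: all pairs whose rigidity row lies in the row space of `G`.
Passing to `H` adds no rank, so it suffices to bound the rank of `H` from below.

If the `H`-neighbourhood of some vertex is a clique, that clique contains at least half of the
vertices. By the degree condition every vertex outside it has at least `D` neighbours in it, and
attaching such a vertex adds `D` to the rank. Starting from a clique, which has full rank, this
yields rigidity (`le_indRank_of_isClique`).

Otherwise every vertex `v` has two `H`-neighbours `x`, `y` that are not adjacent in `H`. If `v` is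
attached to a set containing `x`, `y` and at least `D + 1` neighbours of `v`, the rank grows by `D +
1`: moving `v` to the midpoint of `x` and `y` makes the missing row `xy` a combination of the rows
`vx` and `vy` (`indRank_add_succ_le`). A greedy set `S` of size `O(d log n)` supplies the `D + 1`
neighbours. Averaging over subsets `T` gives an insertion order in which an eighth of the vertices
outside `S` come after their `x` and `y`. The rank of `H` is then at least `(D + 1/8)(n - |S|)`,
which exceeds the universal bound `D n - (D+1 choose 2)` once `|S| (8 D + 1) < n`. Since `|S| D` is
of order `d² log n`, the hypothesis on `d` excludes this case. -/

open Module

namespace RigidityRow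

/-! ### Linear independence as a polynomial condition -/

section Gram

/-- The rows of a real matrix are linearly independent iff its Gram determinant is nonzero. -/
theorem linearIndependent_iff_det_mul_transpose_ne_zero {ι N : Type*} [Fintype ι] [DecidableEq ι]
    [Fintype N] (A : Matrix ι N ℝ) :
    LinearIndependent ℝ A.row ↔ (A * A.transpose).det ≠ 0 := by
  have h1 : LinearIndependent ℝ A.row ↔ Fintype.card ι = A.rank := by
    rw [linearIndependent_iff_card_eq_finrank_span, Matrix.rank_eq_finrank_span_row]; rfl
  have h2 : LinearIndependent ℝ (A * A.transpose).row ↔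
      Fintype.card ι = (A * A.transpose).rank := by
    rw [linearIndependent_iff_card_eq_finrank_span, Matrix.rank_eq_finrank_span_row]; rfl
  rw [h1, ← Matrix.rank_self_mul_transpose, ← h2, Matrix.linearIndependent_rows_iff_isUnit,
    Matrix.isUnit_iff_isUnit_det, isUnit_iff_ne_zero]

/-- The Gram determinant of a family of polynomial vectors. -/
noncomputable def gramDet {σ ι N : Type*} [Fintype ι] [DecidableEq ι] [Fintype N]
    (A : Matrix ι N (MvPolynomial σ ℝ)) : MvPolynomial σ ℝ :=
  (A * A.transpose).det

theorem eval_gramDet_ne_zero_iff {σ ι N : Type*} [Fintype ι] [DecidableEq ι] [Fintype N]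
    (A : Matrix ι N (MvPolynomial σ ℝ)) (p : σ → ℝ) :
    MvPolynomial.eval p (gramDet A) ≠ 0 ↔
      LinearIndependent ℝ (fun i x => MvPolynomial.eval p (A i x)) := by
  have := linearIndependent_iff_det_mul_transpose_ne_zero (A.map (MvPolynomial.eval p))
  rw [gramDet, RingHom.map_det, RingHom.mapMatrix_apply, Matrix.map_mul, Matrix.transpose_map]
  exact this.symm

/-- Finitely many nonzero polynomials have a common point of nonvanishing. -/
theorem exists_forall_eval_ne_zero {σ κ : Type*} [Fintype κ] (Q : κ → MvPolynomial σ ℝ) :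
    ∃ p : σ → ℝ, ∀ k, Q k ≠ 0 → MvPolynomial.eval p (Q k) ≠ 0 := by
  classical
  have h : (∏ k ∈ Finset.univ.filter (fun k => Q k ≠ 0), Q k) ≠ 0 :=
    Finset.prod_ne_zero_iff.2 fun k hk => (Finset.mem_filter.1 hk).2
  obtain ⟨p, hp⟩ : ∃ p : σ → ℝ,
      MvPolynomial.eval p (∏ k ∈ Finset.univ.filter (fun k => Q k ≠ 0), Q k) ≠ 0 := by
    by_contra! hc
    exact h (MvPolynomial.funext fun x => by rw [hc x, map_zero])
  refine ⟨p, fun k hk => ?_⟩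
  rw [map_prod, Finset.prod_ne_zero_iff] at hp
  exact hp k (by simp [hk])

end Gram

/-! ### Rigidity rows and generic placements -/

section Generic

variable {V : Type*} [DecidableEq V] {D : ℕ}

/-- The row of the rigidity matrix of the placement `p` belonging to the pair `u, v`. -/
def row (p : V → Fin D → ℝ) (e : V × V) : V × Fin D → ℝ := fun x =>
  (if x.1 = e.1 then p e.1 x.2 - p e.2 x.2 else 0) +
    (if x.1 = e.2 then p e.2 x.2 - p e.1 x.2 else 0)

/-- The span of the rows belonging to a set of pairs. -/
def rowSpan (p : V → Fin D → ℝ) (F : Set (V × V)) : Submodule ℝ (V × Fin D → ℝ) :=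
  Submodule.span ℝ (row p '' F)

/-- A placement is generic if it maximises the rank of every set of pairs, and if its points are
affinely independent as far as the dimension allows. -/
structure IsGeneric (p : V → Fin D → ℝ) : Prop where
  finrank_le : ∀ (q : V → Fin D → ℝ) (F : Set (V × V)),
    finrank ℝ (rowSpan q F) ≤ finrank ℝ (rowSpan p F)
  linearIndependent : ∀ (v : V) (s : Finset V), v ∉ s → s.card ≤ D →
    LinearIndependent ℝ (fun u : s => p v - p u)

/-- Each requirement says that a Gram determinant, a polynomial in the coordinates, is nonzero
whenever it is nonzero for some placement. There are finitely many such polynomials, so a single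
point serves them all. -/
theorem exists_isGeneric [Fintype V] : ∃ p : V → Fin D → ℝ, IsGeneric p := by
  classical
  let A : (B : Finset (V × V)) → Matrix B (V × Fin D) (MvPolynomial (V × Fin D) ℝ) :=
    fun B e x =>
      (if x.1 = e.1.1 then MvPolynomial.X (e.1.1, x.2) - MvPolynomial.X (e.1.2, x.2) else 0) +
      (if x.1 = e.1.2 then MvPolynomial.X (e.1.2, x.2) - MvPolynomial.X (e.1.1, x.2) else 0)
  let C : (vs : V × Finset V) → Matrix vs.2 (Fin D) (MvPolynomial (V × Fin D) ℝ) :=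
    fun vs u i => MvPolynomial.X (vs.1, i) - MvPolynomial.X (u.1, i)
  obtain ⟨P, hP⟩ := exists_forall_eval_ne_zero
    (κ := Finset (V × V) ⊕ (V × Finset V))
    (Sum.elim (fun B => gramDet (A B)) (fun vs => gramDet (C vs)))
  have hA : ∀ (q : V × Fin D → ℝ) B, MvPolynomial.eval q (gramDet (A B)) ≠ 0 ↔
      LinearIndependent ℝ (fun e : B => row (fun v i => q (v, i)) e) := by
    intro q B
    rw [eval_gramDet_ne_zero_iff]
    have : (fun (i : B) x => MvPolynomial.eval q (A B i x)) =
        (fun e : B => row (fun v i => q (v, i)) e) := by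
      funext e x
      simp only [A, row, map_add, apply_ite (MvPolynomial.eval q), map_sub, MvPolynomial.eval_X,
        map_zero]
    rw [this]
  have hC : ∀ (q : V × Fin D → ℝ) vs, MvPolynomial.eval q (gramDet (C vs)) ≠ 0 ↔
      LinearIndependent ℝ (fun u : vs.2 => (fun i => q (vs.1, i)) - (fun i => q (u.1, i))) := by
    intro q vs
    rw [eval_gramDet_ne_zero_iff]
    have : (fun (u : vs.2) i => MvPolynomial.eval q (C vs u i)) =
        (fun u : vs.2 => (fun i => q (vs.1, i)) - (fun i => q (u.1, i))) := by
      funext e x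
      simp [C]
    rw [this]
  refine ⟨fun v i => P (v, i), ?_, ?_⟩
  · intro q F
    obtain ⟨b, hb, hspan, hli⟩ := exists_linearIndependent ℝ (row q '' F)
    obtain ⟨B, hBF, hinj, himg⟩ : ∃ B : Set (V × V), B ⊆ F ∧ Set.InjOn (row q) B ∧
        row q '' B = b := by
      obtain ⟨B, hB, hBij⟩ := Set.SurjOn.exists_bijOn_subset (f := row q) (s := F) hb
      exact ⟨B, hB, hBij.injOn, hBij.image_eq⟩
    have hBfin := Set.toFinite B
    have hliB : LinearIndependent ℝ (fun e : hBfin.toFinset => row q e) := by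
      have h1 : LinearIndepOn ℝ id (row q '' B) := by rw [himg]; exact hli
      have h2 : LinearIndepOn ℝ (row q) B := (linearIndepOn_iff_image hinj).2 h1
      exact h2.comp (fun e : hBfin.toFinset => (⟨e.1, by simpa using e.2⟩ : B))
        (fun a b h => Subtype.ext (congrArg (fun z : B => z.1) h))
    -- Independence of the rows of `B` at `q` shows that the Gram polynomial of `B` is not
    -- identically zero, so these rows stay independent at `P`.
    have hq := (hA (fun x => q x.1 x.2) hBfin.toFinset).2 hliB
    have hp := (hA P hBfin.toFinset).1 (hP (Sum.inl hBfin.toFinset)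
      (fun h0 => hq (by simp only [Sum.elim_inl] at h0; rw [h0, map_zero])))
    have e1 : finrank ℝ (rowSpan q F) = hBfin.toFinset.card := by
      have := finrank_span_eq_card hliB
      rw [Fintype.card_coe] at this
      have himg' : row q '' B = Set.range (fun e : hBfin.toFinset => row q e) := by
        ext w; simp
      rw [rowSpan, ← hspan, ← himg, ← this, himg']
    have e2 := finrank_span_eq_card hp
    rw [Fintype.card_coe] at e2
    rw [e1, ← e2]
    apply Submodule.finrank_mono
    apply Submodule.span_mono
    rintro _ ⟨e, rfl⟩
    exact ⟨e.1, hBF (by simpa using e.2), rfl⟩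
  · intro v s hv hs
    obtain ⟨f⟩ : Nonempty (s ↪ Fin D) :=
      Function.Embedding.nonempty_of_card_le (by simpa using hs)
    -- With `v` at the origin and the points of `s` at distinct negated basis vectors, the
    -- differences become distinct basis vectors.
    let q : V × Fin D → ℝ := fun x => if h : x.1 ∈ s then (if f ⟨x.1, h⟩ = x.2 then -1 else 0) else 0
    have hq : LinearIndependent ℝ (fun u : s => (fun i => q (v, i)) - (fun i => q (u.1, i))) := by
      have : (fun u : s => (fun i => q (v, i)) - (fun i => q (u.1, i))) =
          (fun i : Fin D => (Pi.single i 1 : Fin D → ℝ)) ∘ f := by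
        funext u i
        simp [q, hv, Pi.single_apply, eq_comm]
        split_ifs <;> simp
      rw [this]
      exact (Pi.linearIndependent_single_one (Fin D) ℝ).comp _ f.injective
    have hq' := (hC q (v, s)).2 hq
    exact (hC P (v, s)).1 (hP (Sum.inr (v, s))
      (fun h0 => hq' (by simp only [Sum.elim_inr] at h0; rw [h0, map_zero])))

end Generic

/-- Rank-nullity for `f` restricted to `W`. It is used with `f` the coordinate block of a new
vertex: `A` collects rows vanishing on that block, `B` is what the new rows cover there. -/
theorem finrank_add_finrank_le {K E F : Type*} [Field K] [AddCommGroup E] [Module K E]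
    [FiniteDimensional K E] [AddCommGroup F] [Module K F] [FiniteDimensional K F] (f : E →ₗ[K] F)
    {W A : Submodule K E} {B : Submodule K F} (hAW : A ≤ W) (hA : A ≤ LinearMap.ker f)
    (hB : B ≤ W.map f) : finrank K A + finrank K B ≤ finrank K W := by
  have h := LinearMap.finrank_range_add_finrank_ker (f.domRestrict W)
  have h1 : finrank K B ≤ finrank K (LinearMap.range (f.domRestrict W)) := by
    rw [LinearMap.range_domRestrict]
    exact Submodule.finrank_mono hB
  have h2 : finrank K A ≤ finrank K (LinearMap.ker (f.domRestrict W)) := by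
    rw [LinearMap.ker_domRestrict, ← Submodule.finrank_map_subtype_eq, Submodule.map_comap_subtype]
    exact Submodule.finrank_mono (le_inf hAW hA)
  omega

/-! ### Rank gain from adding a vertex, and the upper bound from isometries -/

section Extension

variable {V : Type*} {D : ℕ}

/-- The block of coordinates belonging to the vertex `v`. -/
def block (v : V) : (V × Fin D → ℝ) →ₗ[ℝ] (Fin D → ℝ) :=
  LinearMap.funLeft ℝ ℝ fun i => (v, i)

@[simp]
theorem block_apply (v : V) (w : V × Fin D → ℝ) (i : Fin D) : block v w i = w (v, i) := rfl

/-- The ordered pairs of adjacent vertices of `H` inside `X`. -/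
def edgesIn (H : SimpleGraph V) (X : Finset V) : Set (V × V) :=
  {e | e.1 ∈ X ∧ e.2 ∈ X ∧ H.Adj e.1 e.2}

theorem edgesIn_mono (H : SimpleGraph V) {X Y : Finset V} (h : X ⊆ Y) :
    edgesIn H X ⊆ edgesIn H Y :=
  fun _ he => ⟨h he.1, h he.2.1, he.2.2⟩

/-- The matrix whose columns span the infinitesimal isometries: translations are indexed by the
diagonal of `Sym2 (Fin D)`, rotations by its other elements. -/
def isometryMatrix (p : V → Fin D → ℝ) : Matrix (V × Fin D) (Sym2 (Fin D)) ℝ :=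
  fun x e => (if e = s(x.2, x.2) then 1 else 0) +
    ∑ j, if e = s(x.2, j) then ((if x.2 < j then 1 else if j < x.2 then -1 else 0) * p x.1 j) else 0

theorem isometryMatrix_mulVec (p : V → Fin D → ℝ) (b : Sym2 (Fin D) → ℝ) (x : V × Fin D) :
    (isometryMatrix p).mulVec b x = b s(x.2, x.2) +
      ∑ j, (if x.2 < j then 1 else if j < x.2 then -1 else 0) * b s(x.2, j) * p x.1 j := by
  simp only [Matrix.mulVec, dotProduct, isometryMatrix, add_mul, Finset.sum_add_distrib,
    Finset.sum_mul]
  rw [Finset.sum_comm]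
  congr 1
  · simp
  · refine Finset.sum_congr rfl fun j _ => ?_
    simp only [ite_mul, zero_mul]
    rw [Finset.sum_ite_eq' Finset.univ]
    simp only [Finset.mem_univ, if_true]
    split_ifs <;> ring

theorem sum_mul_antisymm {D : ℕ} (S : Fin D → Fin D → ℝ) (hS : ∀ i j, S i j = -S j i)
    (a : Fin D → ℝ) : ∑ i, a i * ∑ j, S i j * a j = 0 := by
  have h : ∑ i, a i * ∑ j, S i j * a j = -∑ i, a i * ∑ j, S i j * a j := by
    conv_lhs => simp only [Finset.mul_sum]
    rw [Finset.sum_comm]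
    simp only [Finset.mul_sum, ← Finset.sum_neg_distrib]
    refine Finset.sum_congr rfl fun i _ => Finset.sum_congr rfl fun j _ => ?_
    rw [hS j i]; ring
  linarith

variable [DecidableEq V]

theorem row_mem_rowSpan {p : V → Fin D → ℝ} {F : Set (V × V)} {e : V × V} (he : e ∈ F) :
    row p e ∈ rowSpan p F :=
  Submodule.subset_span ⟨e, he, rfl⟩

theorem rowSpan_mono (p : V → Fin D → ℝ) {F F' : Set (V × V)} (h : F ⊆ F') :
    rowSpan p F ≤ rowSpan p F' :=
  Submodule.span_mono (Set.image_mono h)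

theorem row_swap (p : V → Fin D → ℝ) (u v : V) : row p (u, v) = row p (v, u) := by
  funext x
  simp only [row]
  ring

theorem row_congr {p q : V → Fin D → ℝ} {u v : V} (hu : p u = q u) (hv : p v = q v) :
    row p (u, v) = row q (u, v) := by
  funext x
  simp only [row, hu, hv]

theorem rowSpan_congr {p q : V → Fin D → ℝ} {F : Set (V × V)}
    (h : ∀ e ∈ F, p e.1 = q e.1 ∧ p e.2 = q e.2) : rowSpan p F = rowSpan q F := by
  unfold rowSpan
  congr 1
  exact Set.image_congr fun e he => row_congr (h e he).1 (h e he).2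

theorem block_row (p : V → Fin D → ℝ) {u v : V} (h : v ≠ u) :
    block v (row p (v, u)) = p v - p u := by
  funext i
  simp [row, h]

theorem block_row_of_ne (p : V → Fin D → ℝ) {u v w : V} (hu : v ≠ u) (hw : v ≠ w) :
    block v (row p (u, w)) = 0 := by
  funext i
  simp [row, hu, hw]

theorem rowSpan_edgesIn_le_ker (p : V → Fin D → ℝ) (H : SimpleGraph V) {X : Finset V} {v : V}
    (hv : v ∉ X) : rowSpan p (edgesIn H X) ≤ LinearMap.ker (block v) := by
  refine Submodule.span_le.2 ?_
  rintro _ ⟨⟨u, w⟩, ⟨hu, hw, -⟩, rfl⟩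
  exact block_row_of_ne p (fun h => hv (h ▸ hu)) (fun h => hv (h ▸ hw))

/-- The rank of the rows of `H` inside `X`. -/
noncomputable def indRank (H : SimpleGraph V) (p : V → Fin D → ℝ) (X : Finset V) : ℕ :=
  finrank ℝ (rowSpan p (edgesIn H X))

theorem span_sub_eq_top {p : V → Fin D → ℝ} (hp : IsGeneric p) {v : V} {s : Finset V}
    (hv : v ∉ s) (hs : s.card = D) :
    Submodule.span ℝ (Set.range fun u : s => p v - p u) = ⊤ := by
  apply Submodule.eq_top_of_finrank_eq
  rw [finrank_span_eq_card (hp.linearIndependent v s hv hs.le)]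
  simp [hs]

theorem rigidityMatrix_apply (G : SimpleGraph V) (p : V → Fin D → ℝ) {u v : V}
    (h : s(u, v) ∈ G.edgeSet) : G.rigidityMatrix p ⟨s(u, v), h⟩ = row p (u, v) := by
  have hne : u ≠ v := G.ne_of_adj h
  funext x
  simp only [SimpleGraph.rigidityMatrix, Matrix.of_apply, row]
  by_cases hx : x.1 ∈ s(u, v)
  · rw [dif_pos hx]
    have hother := Sym2.other_spec hx
    rcases Sym2.mem_iff.1 hx with h1 | h1
    · have h2 : Sym2.Mem.other hx = v := by
        have h3 : s(x.1, Sym2.Mem.other hx) = s(x.1, v) := by rw [hother, h1]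
        exact Sym2.congr_right.1 h3
      rw [h2]; simp [h1, hne]
    · have h2 : Sym2.Mem.other hx = u := by
        have h3 : s(x.1, Sym2.Mem.other hx) = s(x.1, u) := by
          rw [hother, h1]; exact Sym2.eq_swap
        exact Sym2.congr_right.1 h3
      rw [h2]; simp [h1, hne.symm]
  · rw [dif_neg hx]
    rw [Sym2.mem_iff, not_or] at hx
    simp [hx.1, hx.2]

variable [Fintype V]

/-- Adding a vertex with `k ≤ D` neighbours increases the rank by at least `k`. -/
theorem indRank_add_card_le {p : V → Fin D → ℝ} (hp : IsGeneric p) (H : SimpleGraph V)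
    {X s : Finset V} {v : V} (hv : v ∉ X) (hs : s ⊆ X) (hadj : ∀ u ∈ s, H.Adj v u)
    (hcard : s.card ≤ D) : indRank H p X + s.card ≤ indRank H p (insert v X) := by
  have hli := hp.linearIndependent v s (fun h => hv (hs h)) hcard
  have hB := finrank_span_eq_card hli
  rw [Fintype.card_coe] at hB
  rw [← hB]
  refine finrank_add_finrank_le (block v)
    (rowSpan_mono p (edgesIn_mono H (Finset.subset_insert v X)))
    (rowSpan_edgesIn_le_ker p H hv) (Submodule.span_le.2 ?_)
  rintro _ ⟨u, rfl⟩
  have hne : v ≠ u := fun h => hv (h ▸ hs u.2)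
  exact ⟨row p (v, u), row_mem_rowSpan ⟨Finset.mem_insert_self _ _,
    Finset.mem_insert_of_mem (hs u.2), hadj u u.2⟩, block_row p hne⟩

/-- Adding a vertex with at least `D + 1` neighbours, two of which span a pair outside the closure
of the edges already present, increases the rank by at least `D + 1`. -/
theorem indRank_add_succ_le {p : V → Fin D → ℝ} (hp : IsGeneric p) (H : SimpleGraph V)
    {X s : Finset V} {v x y : V} (hv : v ∉ X) (hs : s ⊆ X) (hadj : ∀ u ∈ s, H.Adj v u)
    (hcard : D + 1 ≤ s.card) (hx : x ∈ s) (hy : y ∈ s) (hxy : x ≠ y)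
    (hrow : row p (x, y) ∉ rowSpan p (edgesIn H X)) :
    indRank H p X + (D + 1) ≤ indRank H p (insert v X) := by
  obtain ⟨t, hyt, hts, htc⟩ : ∃ t : Finset V, {y} ⊆ t ∧ t ⊆ s.erase x ∧ t.card = D := by
    have hyx : y ∈ s.erase x := Finset.mem_erase.2 ⟨hxy.symm, hy⟩
    have h1 : (s.erase x).card = s.card - 1 := Finset.card_erase_of_mem hx
    have h2 : 2 ≤ s.card := Finset.one_lt_card.2 ⟨x, hx, y, hy, hxy⟩
    -- For `D = 0` no set `t` of size `D` can contain `y`, but then all rows vanish, contradicting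
    -- `hrow`.
    rcases Nat.eq_zero_or_pos D with h0 | h0
    · exfalso
      subst h0
      apply hrow
      have : row p (x, y) = 0 := by
        funext z; exact z.2.elim0
      rw [this]; exact zero_mem _
    exact Finset.exists_subsuperset_card_eq (Finset.singleton_subset_iff.2 hyx)
      (by rw [Finset.card_singleton]; exact h0) (by omega)
  have hvne : ∀ u ∈ X, v ≠ u := fun u hu h => hv (h ▸ hu)
  -- The placement with `v` at the midpoint of `p x` and `p y` is special, but its rank is a lower
  -- bound for the generic one.
  let q : V → Fin D → ℝ := Function.update p v ((1 / 2 : ℝ) • (p x + p y))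
  have hqv : q v = (1 / 2 : ℝ) • (p x + p y) := Function.update_self _ _ _
  have hqX : ∀ u ∈ X, q u = p u := fun u hu => Function.update_of_ne (hvne u hu).symm _ _
  refine le_trans ?_ (hp.finrank_le q (edgesIn H (insert v X)))
  have hXq : rowSpan p (edgesIn H X) = rowSpan q (edgesIn H X) :=
    rowSpan_congr fun e he => ⟨(hqX _ he.1).symm, (hqX _ he.2.1).symm⟩
  have hmem : ∀ u ∈ s, row q (v, u) ∈ rowSpan q (edgesIn H (insert v X)) := fun u hu =>
    row_mem_rowSpan ⟨Finset.mem_insert_self _ _, Finset.mem_insert_of_mem (hs hu), hadj u hu⟩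
  have hsum : row q (x, y) = (2 : ℝ) • (row q (v, x) + row q (v, y)) := by
    funext z
    have hxv := hvne x (hs hx)
    have hyv := hvne y (hs hy)
    simp only [row, Pi.smul_apply, Pi.add_apply, hqv, hqX x (hs hx), hqX y (hs hy), smul_eq_mul]
    by_cases h1 : z.1 = v
    · simp [h1, hxv, hyv]; ring
    · by_cases h2 : z.1 = x
      · simp [h2, hxv.symm, hxy]; ring
      · by_cases h3 : z.1 = y
        · simp [h3, hyv.symm, hxy.symm]; ring
        · simp [h1, h2, h3]
  have hlt : finrank ℝ (rowSpan p (edgesIn H X)) + 1 ≤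
      finrank ℝ (rowSpan q (edgesIn H X) ⊔ Submodule.span ℝ {row q (x, y)} : Submodule ℝ _) := by
    rw [hXq]
    apply Submodule.finrank_lt_finrank_of_lt
    refine lt_of_le_of_ne le_sup_left fun heq => hrow ?_
    rw [hXq, row_congr (hqX x (hs hx)).symm (hqX y (hs hy)).symm, heq]
    exact Submodule.mem_sup_right (Submodule.mem_span_singleton_self _)
  have key := finrank_add_finrank_le (block v) (W := rowSpan q (edgesIn H (insert v X)))
    (A := rowSpan q (edgesIn H X) ⊔ Submodule.span ℝ {row q (x, y)}) (B := ⊤) ?_ ?_ ?_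
  · rw [finrank_top, finrank_fin_fun] at key
    unfold indRank
    omega
  · refine sup_le (rowSpan_mono q (edgesIn_mono H (Finset.subset_insert v X))) ?_
    rw [Submodule.span_singleton_le_iff_mem, hsum]
    exact Submodule.smul_mem _ _ (Submodule.add_mem _ (hmem x hx) (hmem y hy))
  · refine sup_le (rowSpan_edgesIn_le_ker q H hv) ?_
    rw [Submodule.span_singleton_le_iff_mem]
    exact block_row_of_ne q (hvne x (hs hx)) (hvne y (hs hy))
  -- The points `v`, `x`, `y` are collinear under `q`, so genericity is applied at `x` instead: the
  -- row of `vu` minus that of `vx` has block `p x - p u`, and these differences span as `u` runs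
  -- over `t`.
  · rw [← span_sub_eq_top hp (v := x) (s := t) (fun h => by simpa using hts h) htc,
      Submodule.span_le]
    rintro _ ⟨u, rfl⟩
    have hu : u.1 ∈ s := Finset.mem_of_mem_erase (hts u.2)
    refine ⟨row q (v, u) - row q (v, x), Submodule.sub_mem _ (hmem u hu) (hmem x hx), ?_⟩
    rw [map_sub, block_row q (hvne u (hs hu)), block_row q (hvne x (hs hx)), hqX u (hs hu),
      hqX x (hs hx)]
    exact sub_sub_sub_cancel_left _ _ _

theorem row_dotProduct (p : V → Fin D → ℝ) (e : V × V) (w : V × Fin D → ℝ) :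
    row p e ⬝ᵥ w = ∑ i, (p e.1 i - p e.2 i) * (w (e.1, i) - w (e.2, i)) := by
  simp only [dotProduct, row, Fintype.sum_prod_type, add_mul, ite_mul, zero_mul,
    Finset.sum_add_distrib]
  rw [Finset.sum_comm, Finset.sum_comm (s := Finset.univ (α := V))]
  simp only [Finset.sum_ite_eq', Finset.mem_univ, if_true]
  rw [← Finset.sum_add_distrib]
  exact Finset.sum_congr rfl fun i _ => by ring

/-- Translations cancel in the difference of the two endpoints. What remains is the quadratic form
of an antisymmetric matrix at `p e.1 - p e.2`. -/
theorem row_dotProduct_isometryMatrix (p : V → Fin D → ℝ) (e : V × V) (b : Sym2 (Fin D) → ℝ) :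
    row p e ⬝ᵥ (isometryMatrix p).mulVec b = 0 := by
  rw [row_dotProduct]
  simp only [isometryMatrix_mulVec]
  refine Eq.trans ?_ (sum_mul_antisymm
    (fun i j => (if i < j then 1 else if j < i then -1 else 0) * b s(i, j)) ?_
    (fun i => p e.1 i - p e.2 i))
  · refine Finset.sum_congr rfl fun i _ => ?_
    congr 1
    rw [add_sub_add_left_eq_sub, ← Finset.sum_sub_distrib]
    exact Finset.sum_congr rfl fun j _ => by ring
  · intro i j
    rw [Sym2.eq_swap]
    rcases lt_trichotomy i j with h | h | h
    · simp [h, h.not_gt]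
    · simp [h]
    · simp [h, h.not_gt]

/-- Subtract the motion at two vertices: each row of the rotation part annihilates all differences
`p v - p u`, which span `ℝ^D`, so it is zero. The translation part then vanishes too. -/
theorem isometryMatrix_mulVec_injective {p : V → Fin D → ℝ} (hp : IsGeneric p)
    (hV : D + 1 ≤ Fintype.card V) : Function.Injective (isometryMatrix p).mulVec := by
  have hker : ∀ b, (isometryMatrix p).mulVec b = 0 → b = 0 := by
    intro b hb
    obtain ⟨v⟩ : Nonempty V := Fintype.card_pos_iff.1 (by omega)
    obtain ⟨s, hs, hsc⟩ := Finset.exists_subset_card_eq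
      (s := Finset.univ.erase v) (n := D) (by simp; omega)
    have htop := span_sub_eq_top hp (v := v) (s := s) (fun h => by simpa using hs h) hsc
    have hb' : ∀ u i, b s(i, i) +
        ∑ j, (if i < j then 1 else if j < i then -1 else 0) * b s(i, j) * p u j = 0 := by
      intro u i
      have := congrFun hb (u, i)
      rwa [isometryMatrix_mulVec] at this
    have hrot : ∀ i j, (if i < j then (1 : ℝ) else if j < i then -1 else 0) * b s(i, j) = 0 := by
      intro i j
      let f : (Fin D → ℝ) →ₗ[ℝ] ℝ := ∑ j, ((if i < j then (1 : ℝ) else if j < i then -1 else 0)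
        * b s(i, j)) • LinearMap.proj j
      have hf : f = 0 := by
        apply LinearMap.ker_eq_top.1
        rw [eq_top_iff, ← htop, Submodule.span_le]
        rintro _ ⟨u, rfl⟩
        have h1 := hb' v i
        have h2 := hb' u i
        simp only [f, SetLike.mem_coe, LinearMap.mem_ker, LinearMap.sum_apply,
          LinearMap.smul_apply, LinearMap.proj_apply, Pi.sub_apply, smul_eq_mul, mul_sub,
          Finset.sum_sub_distrib]
        linarith
      have := LinearMap.congr_fun hf (Pi.single j 1)
      simpa only [f, LinearMap.sum_apply, LinearMap.smul_apply, LinearMap.proj_apply, smul_eq_mul,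
        Pi.single_apply, mul_ite, mul_one, mul_zero, Finset.sum_ite_eq', Finset.sum_ite_eq,
        Finset.mem_univ, if_true, LinearMap.zero_apply] using this
    funext e
    induction e using Sym2.ind with
    | _ i j =>
      rcases lt_trichotomy i j with h | h | h
      · simpa [h] using hrot i j
      · subst h
        have := hb' v i
        simpa only [hrot, zero_mul, Finset.sum_const_zero, add_zero, Pi.zero_apply] using this
      · simpa [h, h.not_gt] using hrot i j
  intro a b hab
  have := hker (a - b) (by rw [Matrix.mulVec_sub, hab, sub_self])
  exact sub_eq_zero.1 this

theorem rank_rigidityMatrix (G : SimpleGraph V) (p : V → Fin D → ℝ) :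
    (G.rigidityMatrix p).rank = indRank G p Finset.univ := by
  rw [Matrix.rank_eq_finrank_span_row, indRank, rowSpan]
  have : Set.range (G.rigidityMatrix p).row = row p '' edgesIn G Finset.univ := ?_
  · rw [this]
  ext w
  constructor
  · rintro ⟨⟨e, he⟩, rfl⟩
    induction e using Sym2.ind with
    | _ u v => exact ⟨(u, v), ⟨by simp, by simp, he⟩, (rigidityMatrix_apply G p he).symm⟩
  · rintro ⟨⟨u, v⟩, ⟨-, -, h⟩, rfl⟩
    exact ⟨⟨s(u, v), h⟩, rigidityMatrix_apply G p h⟩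

/-- The infinitesimal isometries form a space of dimension `(D + 1).choose 2` inside the kernel of
the rigidity matrix. -/
theorem rank_rigidityMatrix_add_le (G : SimpleGraph V) {p : V → Fin D → ℝ} (hp : IsGeneric p)
    (hV : D + 1 ≤ Fintype.card V) :
    (G.rigidityMatrix p).rank + (D + 1).choose 2 ≤ D * Fintype.card V := by
  have hmul : G.rigidityMatrix p * isometryMatrix p = 0 := by
    apply Matrix.ext_of_mulVec_single
    intro c
    rw [← Matrix.mulVec_mulVec, Matrix.zero_mulVec]
    funext ⟨e, he⟩
    induction e using Sym2.ind with
    | _ u v =>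
      rw [Matrix.mulVec, rigidityMatrix_apply]
      exact row_dotProduct_isometryMatrix p _ _
  have h := Matrix.rank_add_rank_le_card_of_mul_eq_zero hmul
  have h2 : (isometryMatrix p).rank = (D + 1).choose 2 := by
    have hli := Matrix.mulVec_injective_iff.1 (isometryMatrix_mulVec_injective hp hV)
    rw [← Matrix.rank_transpose, LinearIndependent.rank_matrix (by simpa using hli), Sym2.card,
      Fintype.card_fin]
  rw [h2, Fintype.card_prod, Fintype.card_fin, mul_comm] at h
  exact h

end Extension

/-! ### Small multiply dominating sets and an averaging argument -/

section Domination

variable {V : Type*} [Fintype V] [DecidableEq V] (G : SimpleGraph V) [DecidableRel G.Adj]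

/-- Greedy construction of a small set, avoiding `F`, that leaves few vertices undominated. -/
theorem exists_card_undominated_le (hδ : ∀ v, Fintype.card V ≤ 2 * G.degree v) {F : Finset V}
    (hF : 6 * F.card ≤ Fintype.card V) (k : ℕ) :
    ∃ A : Finset V, Disjoint A F ∧ A.card ≤ k ∧
      3 ^ k * (Finset.univ.filter fun v => ∀ a ∈ A, ¬G.Adj v a).card ≤
        2 ^ k * Fintype.card V := by
  induction k with
  | zero => exact ⟨∅, by simp, by simp, by simp⟩
  | succ k ih =>
    obtain ⟨A, hAF, hAk, hA⟩ := ih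
    set U := Finset.univ.filter fun v => ∀ a ∈ A, ¬G.Adj v a with hU
    rcases U.eq_empty_or_nonempty with h0 | ⟨u₀, -⟩
    · exact ⟨A, hAF, by omega, by rw [← hU, h0]; simp⟩
    have hVpos : 0 < Fintype.card V := Fintype.card_pos_iff.2 ⟨u₀⟩
    have hne : (Fᶜ).Nonempty := by
      rw [← Finset.card_pos, Finset.card_compl]; omega
    have hdouble : ∑ a ∈ Fᶜ, (U.filter fun u => G.Adj u a).card =
        ∑ u ∈ U, ((Fᶜ).filter fun a => G.Adj u a).card := by
      simp only [Finset.card_filter]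
      exact Finset.sum_comm
    -- At least `n/2 - n/6 = n/3` neighbours of `u` avoid `F`. By double counting some `a` outside
    -- `F` is therefore adjacent to a third of `U`.
    have hdeg : ∀ u ∈ U, Fintype.card V ≤ 3 * ((Fᶜ).filter fun a => G.Adj u a).card := by
      intro u _
      have h1 : G.neighborFinset u ⊆ ((Fᶜ).filter fun a => G.Adj u a) ∪ F := by
        intro a ha
        rw [SimpleGraph.mem_neighborFinset] at ha
        by_cases haF : a ∈ F <;> simp [haF, ha]
      have h2 := (Finset.card_le_card h1).trans (Finset.card_union_le _ _)
      rw [SimpleGraph.card_neighborFinset_eq_degree] at h2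
      have := hδ u
      omega
    obtain ⟨a, haF, ha⟩ := Finset.exists_le_of_sum_le (s := Fᶜ) (f := fun _ => U.card)
      (g := fun a => 3 * (U.filter fun u => G.Adj u a).card) hne (by
        rw [Finset.sum_const, smul_eq_mul, ← Finset.mul_sum, hdouble, Finset.mul_sum]
        calc (Fᶜ).card * U.card ≤ U.card * Fintype.card V := by
              rw [mul_comm]; exact Nat.mul_le_mul_left _ (Finset.card_le_univ _)
          _ = ∑ u ∈ U, Fintype.card V := by rw [Finset.sum_const, smul_eq_mul]
          _ ≤ _ := Finset.sum_le_sum hdeg)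
    refine ⟨insert a A, ?_, (Finset.card_insert_le _ _).trans (by omega), ?_⟩
    · rw [Finset.disjoint_insert_left]
      exact ⟨by simpa using haF, hAF⟩
    have hU' : (Finset.univ.filter fun v => ∀ b ∈ insert a A, ¬G.Adj v b) =
        U.filter fun u => ¬G.Adj u a := by
      ext v
      simp [hU, and_comm]
    have hsplit := Finset.card_filter_add_card_filter_not (s := U) (fun u => G.Adj u a)
    have h3 : 3 * (U.filter fun u => ¬G.Adj u a).card ≤ 2 * U.card := by
      have : U.card ≤ 3 * (U.filter fun u => G.Adj u a).card := ha
      omega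
    rw [hU', pow_succ, pow_succ]
    calc 3 ^ k * 3 * (U.filter fun u => ¬G.Adj u a).card
        = 3 ^ k * (3 * (U.filter fun u => ¬G.Adj u a).card) := by ring
      _ ≤ 3 ^ k * (2 * U.card) := Nat.mul_le_mul_left _ h3
      _ = 2 * (3 ^ k * U.card) := by ring
      _ ≤ 2 * (2 ^ k * Fintype.card V) := Nat.mul_le_mul_left _ hA
      _ = _ := by ring

/-- A small set in which every vertex has at least `j` neighbours. -/
theorem exists_card_le_forall_le_card_filter_adj
    (hδ : ∀ v, Fintype.card V ≤ 2 * G.degree v) {k : ℕ}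
    (hk : 2 ^ k * Fintype.card V < 3 ^ k) (j : ℕ) (hj : 6 * (j * k) ≤ Fintype.card V) :
    ∃ S : Finset V, S.card ≤ j * k ∧ ∀ v, j ≤ (S.filter fun u => G.Adj v u).card := by
  induction j with
  | zero => exact ⟨∅, by simp, by simp⟩
  | succ j ih =>
    have hjk : j * k ≤ (j + 1) * k := Nat.mul_le_mul_right _ (Nat.le_succ j)
    obtain ⟨S, hSc, hS⟩ := ih (by omega)
    -- Keeping `A` disjoint from `S` makes the neighbour found in `A` a new one.
    obtain ⟨A, hAS, hAk, hA⟩ := exists_card_undominated_le G hδ (F := S) (by omega) k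
    refine ⟨S ∪ A, (Finset.card_union_le _ _).trans (by rw [add_mul]; omega), fun v => ?_⟩
    have h0 : (Finset.univ.filter fun v => ∀ a ∈ A, ¬G.Adj v a).card = 0 := by
      by_contra hne
      have : 3 ^ k * 1 ≤ 3 ^ k * (Finset.univ.filter fun v => ∀ a ∈ A, ¬G.Adj v a).card :=
        Nat.mul_le_mul_left _ (by omega)
      omega
    have hex : ∃ a ∈ A, G.Adj v a := by
      by_contra! hno
      have : v ∈ Finset.univ.filter fun v => ∀ a ∈ A, ¬G.Adj v a := by simpa using hno
      rw [Finset.card_eq_zero.1 h0] at this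
      simp at this
    obtain ⟨a, ha, hva⟩ := hex
    have haf : 0 < (A.filter fun u => G.Adj v u).card :=
      Finset.card_pos.2 ⟨a, by simp [ha, hva]⟩
    rw [Finset.filter_union, Finset.card_union_of_disjoint
      (Finset.disjoint_filter_filter hAS.symm)]
    have := hS v
    omega

/-- If each `v` has two other elements `x v ≠ y v` assigned to it, some set `T` contains
`x v` and `y v` but not `v` for at least an eighth of all `v ∈ R`. -/
theorem exists_card_le_eight_mul_card_filter {V : Type*} [Fintype V] [DecidableEq V] (R : Finset V)
    (x y : V → V) (hx : ∀ v, x v ≠ v) (hy : ∀ v, y v ≠ v) (hxy : ∀ v, x v ≠ y v) :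
    ∃ T : Finset V,
      R.card ≤ 8 * (R.filter fun v => v ∉ T ∧ x v ∈ T ∧ y v ∈ T).card := by
  -- The admissible `T` form the interval from `{x v, y v}` to the complement of `v`, with `2 ^ (n -
  -- 3)` members: an eighth of all subsets.
  have hcount : ∀ v, 8 * ((Finset.univ : Finset (Finset V)).filter
      fun T => v ∉ T ∧ x v ∈ T ∧ y v ∈ T).card = 2 ^ Fintype.card V := by
    intro v
    have hsub : ({x v, y v} : Finset V) ⊆ Finset.univ.erase v := by
      intro z hz
      rcases Finset.mem_insert.1 hz with rfl | hz
      · simp [hx v]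
      · rw [Finset.mem_singleton.1 hz]; simp [hy v]
    have hIcc : ((Finset.univ : Finset (Finset V)).filter
        fun T => v ∉ T ∧ x v ∈ T ∧ y v ∈ T) = Finset.Icc {x v, y v} (Finset.univ.erase v) := by
      ext T
      simp only [Finset.mem_filter, Finset.mem_univ, true_and, Finset.mem_Icc,
        Finset.insert_subset_iff, Finset.singleton_subset_iff, Finset.subset_erase,
        Finset.subset_univ]
      tauto
    have h2 : ({x v, y v} : Finset V).card = 2 := Finset.card_pair (hxy v)
    have h3 : (Finset.univ.erase v).card = Fintype.card V - 1 := by simp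
    have hle := Finset.card_le_card hsub
    rw [h2, h3] at hle
    rw [hIcc, Finset.card_Icc_finset hsub, h2, h3]
    obtain ⟨m, hm⟩ : ∃ m, Fintype.card V = m + 3 := ⟨Fintype.card V - 3, by omega⟩
    rw [hm, show m + 3 - 1 - 2 = m by omega, pow_add]
    ring
  obtain ⟨T, -, hT⟩ := Finset.exists_le_of_sum_le (s := (Finset.univ : Finset (Finset V)))
    (f := fun _ => R.card)
    (g := fun T => 8 * (R.filter fun v => v ∉ T ∧ x v ∈ T ∧ y v ∈ T).card) ⟨∅, by simp⟩ (by
      have hdouble : ∑ T : Finset V, (R.filter fun v => v ∉ T ∧ x v ∈ T ∧ y v ∈ T).card =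
          ∑ v ∈ R, ((Finset.univ : Finset (Finset V)).filter
            fun T => v ∉ T ∧ x v ∈ T ∧ y v ∈ T).card := by
        simp only [Finset.card_filter]
        exact Finset.sum_comm
      rw [← Finset.mul_sum, hdouble, Finset.mul_sum, Finset.sum_congr rfl fun v _ => hcount v]
      simp [mul_comm])
  exact ⟨T, hT⟩

end Domination

/-! ### Rank bounds from insertion orders -/

section Order

variable {V : Type*} [Fintype V] [DecidableEq V] {D : ℕ} {p : V → Fin D → ℝ}
  (H : SimpleGraph V)

/-- Lower bound for the rank of a clique. -/
theorem mul_card_add_le_indRank_of_isClique (hp : IsGeneric p) (K : Finset V)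
    (hK : H.IsClique (K : Set V)) :
    D * K.card + (D + 1 - K.card).choose 2 ≤ indRank H p K + (D + 1).choose 2 := by
  induction K using Finset.induction_on with
  | empty => simp
  | insert v K hv ih =>
    have ih' := ih (hK.subset (by simp))
    have hadj : ∀ u ∈ K, H.Adj v u := fun u hu =>
      hK (by simp) (by simp [hu]) (fun h => hv (h ▸ hu))
    rw [Finset.card_insert_of_notMem hv, mul_add]
    -- Once `K` has `D` vertices the truncated binomial term is zero and each step gains `D`. Before
    -- that, the step gains only `K.card`, and Pascal's rule accounts for the deficit.
    rcases le_or_gt D K.card with hle | hlt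
    · obtain ⟨s, hs, hsc⟩ := Finset.exists_subset_card_eq hle
      have h := indRank_add_card_le hp H hv hs (fun u hu => hadj u (hs hu)) hsc.le
      have h0 : (D + 1 - (K.card + 1)).choose 2 = 0 := Nat.choose_eq_zero_of_lt (by omega)
      omega
    · have h := indRank_add_card_le hp H hv subset_rfl hadj hlt.le
      obtain ⟨m, hm⟩ : ∃ m, D = K.card + m := ⟨D - K.card, by omega⟩
      have h1 : D + 1 - K.card = m + 1 := by omega
      have h2 : D + 1 - (K.card + 1) = m := by omega
      rw [h1, Nat.choose_succ_succ' m 1, Nat.choose_one_right] at ih'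
      rw [h2]
      simp only [Nat.reduceAdd] at ih'
      omega

variable [DecidableRel H.Adj]

/-- Adding vertices one by one, each with at least `D` neighbours in the initial set. -/
theorem indRank_add_mul_card_le_union (hp : IsGeneric p) (X Z : Finset V) (hXZ : Disjoint X Z)
    (hZ : ∀ v ∈ Z, D ≤ (X.filter fun u => H.Adj v u).card) :
    indRank H p X + D * Z.card ≤ indRank H p (X ∪ Z) := by
  induction Z using Finset.induction_on with
  | empty => simp
  | insert v Z hv ih =>
    rw [Finset.disjoint_insert_right] at hXZ
    have ih' := ih hXZ.2 fun w hw => hZ w (Finset.mem_insert_of_mem hw)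
    obtain ⟨s, hs, hsc⟩ := Finset.exists_subset_card_eq (hZ v (Finset.mem_insert_self _ _))
    have h := indRank_add_card_le hp H (X := X ∪ Z) (s := s) (v := v) (by simp [hXZ.1, hv])
      (fun u hu => Finset.mem_union_left _ (Finset.mem_filter.1 (hs hu)).1)
      (fun u hu => (Finset.mem_filter.1 (hs hu)).2) hsc.le
    rw [Finset.union_insert, Finset.card_insert_of_notMem hv, mul_add]
    omega

/-- Adding vertices one by one, each with at least `D + 1` neighbours in the initial set, among
them two that span a pair outside the closure of the whole graph. -/
theorem indRank_add_succ_mul_card_le_union (hp : IsGeneric p) (X Z : Finset V)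
    (hXZ : Disjoint X Z) (hZ : ∀ v ∈ Z, D + 1 ≤ (X.filter fun u => H.Adj v u).card)
    (hpair : ∀ v ∈ Z, ∃ x ∈ X, ∃ y ∈ X, x ≠ y ∧ H.Adj v x ∧ H.Adj v y ∧
      row p (x, y) ∉ rowSpan p (edgesIn H Finset.univ)) :
    indRank H p X + (D + 1) * Z.card ≤ indRank H p (X ∪ Z) := by
  induction Z using Finset.induction_on with
  | empty => simp
  | insert v Z hv ih =>
    rw [Finset.disjoint_insert_right] at hXZ
    have ih' := ih hXZ.2 (fun w hw => hZ w (Finset.mem_insert_of_mem hw))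
      (fun w hw => hpair w (Finset.mem_insert_of_mem hw))
    obtain ⟨x, hx, y, hy, hxy, hvx, hvy, hrow⟩ := hpair v (Finset.mem_insert_self _ _)
    have h := indRank_add_succ_le hp H (X := X ∪ Z) (s := X.filter fun u => H.Adj v u) (v := v)
      (x := x) (y := y) (by simp [hXZ.1, hv])
      (fun u hu => Finset.mem_union_left _ (Finset.mem_filter.1 hu).1)
      (fun u hu => (Finset.mem_filter.1 hu).2) (hZ v (Finset.mem_insert_self _ _))
      (by simp [hx, hvx]) (by simp [hy, hvy]) hxy
      (fun hmem => hrow (rowSpan_mono p (edgesIn_mono H (Finset.subset_univ _)) hmem))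
    rw [Finset.union_insert, Finset.card_insert_of_notMem hv, mul_add]
    omega

/-- If every vertex has two neighbours spanning a pair outside the closure, the rank is large. -/
theorem succ_mul_card_compl_le_indRank (hp : IsGeneric p) (S : Finset V)
    (hS : ∀ v, D + 1 ≤ (S.filter fun u => H.Adj v u).card)
    (hpair : ∀ v, ∃ x y, x ≠ y ∧ H.Adj v x ∧ H.Adj v y ∧
      row p (x, y) ∉ rowSpan p (edgesIn H Finset.univ)) :
    8 * (D * (Sᶜ).card) + (Sᶜ).card ≤ 8 * indRank H p Finset.univ := by
  choose x y hxy hx hy hrow using hpair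
  obtain ⟨T, hT⟩ := exists_card_le_eight_mul_card_filter Sᶜ x y
    (fun v => (H.ne_of_adj (hx v)).symm) (fun v => (H.ne_of_adj (hy v)).symm) hxy
  -- The insertion order is `S`, then `T \ S`, then `B`, then the rest. When a vertex of `B`
  -- arrives, its `x v` and `y v` are already present, which earns the extra unit of rank.
  set B := (Sᶜ).filter fun v => v ∉ T ∧ x v ∈ T ∧ y v ∈ T with hB
  have hmono : ∀ {X : Finset V}, S ⊆ X → ∀ v, D + 1 ≤ (X.filter fun u => H.Adj v u).card :=
    fun h v => (hS v).trans (Finset.card_le_card (Finset.filter_subset_filter _ h))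
  have h1 := indRank_add_mul_card_le_union H hp S (T \ S) Finset.disjoint_sdiff
    (fun v _ => (Nat.le_succ D).trans (hS v))
  have hBdisj : Disjoint (S ∪ T \ S) B := by
    rw [Finset.disjoint_right]
    intro v hv
    simp only [hB, Finset.mem_filter, Finset.mem_compl] at hv
    simp [hv.1, hv.2.1]
  have h2 := indRank_add_succ_mul_card_le_union H hp (S ∪ T \ S) B hBdisj
    (fun v _ => hmono Finset.subset_union_left v) (by
      intro v hv
      simp only [hB, Finset.mem_filter] at hv
      exact ⟨x v, by simp [hv.2.2.1], y v, by simp [hv.2.2.2], hxy v, hx v, hy v, hrow v⟩)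
  have h3 := indRank_add_mul_card_le_union H hp (S ∪ T \ S ∪ B) (S ∪ T \ S ∪ B)ᶜ
    disjoint_compl_right (fun v _ => (Nat.le_succ D).trans (hmono
      (Finset.subset_union_left.trans Finset.subset_union_left) v))
  rw [Finset.union_compl] at h3
  have hcard : (T \ S).card + B.card + ((S ∪ T \ S ∪ B)ᶜ).card = (Sᶜ).card := by
    have e1 := Finset.card_union_of_disjoint hBdisj
    have e2 := Finset.card_union_of_disjoint (Finset.disjoint_sdiff (s := S) (t := T))
    have e3 := Finset.card_add_card_compl (S ∪ T \ S ∪ B)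
    have e4 := Finset.card_add_card_compl S
    omega
  have hmul : D * (Sᶜ).card =
      D * (T \ S).card + D * B.card + D * ((S ∪ T \ S ∪ B)ᶜ).card := by
    rw [← hcard]; ring
  rw [add_mul, one_mul] at h2
  omega

end Order

/-! ### The closure graph, the dichotomy and the numerical estimate -/

section MinDegree

variable {V : Type*} [Fintype V] [DecidableEq V]

/-- The graph of all pairs whose row lies in the row space of `G`. -/
def closureGraph {D : ℕ} (G : SimpleGraph V) (p : V → Fin D → ℝ) : SimpleGraph V where
  Adj u v := u ≠ v ∧ row p (u, v) ∈ rowSpan p (edgesIn G Finset.univ)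
  symm := ⟨fun u v h => ⟨h.1.symm, row_swap p u v ▸ h.2⟩⟩
  loopless := ⟨fun _ h => h.1 rfl⟩

theorem le_closureGraph {D : ℕ} (G : SimpleGraph V) (p : V → Fin D → ℝ) :
    G ≤ closureGraph G p :=
  fun _ _ h => ⟨G.ne_of_adj h, row_mem_rowSpan ⟨by simp, by simp, h⟩⟩

theorem rowSpan_closureGraph_le {D : ℕ} (G : SimpleGraph V) (p : V → Fin D → ℝ) :
    rowSpan p (edgesIn (closureGraph G p) Finset.univ) ≤ rowSpan p (edgesIn G Finset.univ) := by
  refine Submodule.span_le.2 ?_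
  rintro _ ⟨e, he, rfl⟩
  exact he.2.2.2

/-- The reverse inequality holds for every graph, so only a lower bound on the rank has to be
proved. -/
theorem isRigid_of_le_indRank {D : ℕ} (G : SimpleGraph V) {p : V → Fin D → ℝ} (hp : IsGeneric p)
    (hV : D + 1 ≤ Fintype.card V)
    (h : D * Fintype.card V ≤ indRank G p Finset.univ + (D + 1).choose 2) : G.IsRigid D := by
  refine ⟨hV, p, le_antisymm (rank_rigidityMatrix_add_le G hp hV) ?_⟩
  rwa [rank_rigidityMatrix]

variable (G : SimpleGraph V) [DecidableRel G.Adj] {d : ℕ}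

/-- A vertex outside a set containing half of the vertices has many neighbours in it. -/
theorem succ_le_card_filter_adj (hδ : ∀ v, Fintype.card V + 2 * d ≤ 2 * G.degree v)
    {X : Finset V} (hX : Fintype.card V ≤ 2 * X.card) {v : V} (hv : v ∉ X) :
    d + 1 ≤ (X.filter fun u => G.Adj v u).card := by
  have hsub : G.neighborFinset v ⊆ (X.filter fun u => G.Adj v u) ∪ (Xᶜ).erase v := by
    intro u hu
    rw [SimpleGraph.mem_neighborFinset] at hu
    by_cases huX : u ∈ X
    · simp [huX, hu]
    · simp [huX, (G.ne_of_adj hu).symm]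
  have h1 := (Finset.card_le_card hsub).trans (Finset.card_union_le _ _)
  have h2 := Finset.card_erase_add_one (Finset.mem_compl.2 hv)
  have h3 := Finset.card_add_card_compl X
  rw [SimpleGraph.card_neighborFinset_eq_degree] at h1
  have := hδ v
  omega

/-- In dimension one, a star at `v` covers more than half of the vertices, and every other vertex
has a neighbour in it. This case is separate because the numerical estimate requires `d ≥ 1`. -/
theorem isRigid_one [Nonempty V] (hδ : ∀ v, Fintype.card V ≤ 2 * G.degree v)
    (hV : 2 ≤ Fintype.card V) : G.IsRigid 1 := by
  obtain ⟨p, hp⟩ := exists_isGeneric (V := V) (D := 1)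
  obtain ⟨v⟩ := ‹Nonempty V›
  refine isRigid_of_le_indRank G hp hV ?_
  have hdisj : Disjoint {v} (G.neighborFinset v) := by simp
  have h1 := indRank_add_mul_card_le_union G hp {v} (G.neighborFinset v) hdisj (by
    intro u hu
    rw [SimpleGraph.mem_neighborFinset] at hu
    exact Finset.card_pos.2 ⟨v, by simp [hu.symm]⟩)
  have hcard := Finset.card_union_of_disjoint hdisj
  rw [SimpleGraph.card_neighborFinset_eq_degree, Finset.card_singleton] at hcard
  rw [SimpleGraph.card_neighborFinset_eq_degree] at h1
  have hv := hδ v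
  have h2 := indRank_add_mul_card_le_union G hp ({v} ∪ G.neighborFinset v)
    ({v} ∪ G.neighborFinset v)ᶜ disjoint_compl_right (fun u hu =>
      succ_le_card_filter_adj G (d := 0) (by simpa using hδ) (by omega) (Finset.mem_compl.1 hu))
  rw [Finset.union_compl] at h2
  have h3 := Finset.card_add_card_compl ({v} ∪ G.neighborFinset v)
  have h4 : (1 + 1).choose 2 = 1 := rfl
  omega

/-- If the closure of `G` has a clique on half of the vertices and the minimum degree of `G` is at
least `n / 2 + d`, then the rank of `G` is as large as possible. -/
theorem le_indRank_of_isClique (hδ : ∀ v, Fintype.card V + 2 * d ≤ 2 * G.degree v)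
    {p : V → Fin (d + 1) → ℝ} (hp : IsGeneric p) {K : Finset V}
    (hK : (closureGraph G p).IsClique (K : Set V)) (hKc : Fintype.card V ≤ 2 * K.card) :
    (d + 1) * Fintype.card V ≤ indRank G p Finset.univ + (d + 1 + 1).choose 2 := by
  classical
  have h1 := mul_card_add_le_indRank_of_isClique (closureGraph G p) hp K hK
  have h2 := indRank_add_mul_card_le_union (closureGraph G p) hp K Kᶜ disjoint_compl_right
    (fun v hv => (succ_le_card_filter_adj G hδ hKc (Finset.mem_compl.1 hv)).trans
      (Finset.card_le_card fun u hu => by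
        rw [Finset.mem_filter] at hu ⊢
        exact ⟨hu.1, le_closureGraph G p hu.2⟩))
  rw [Finset.union_compl] at h2
  have h3 : indRank (closureGraph G p) p Finset.univ ≤ indRank G p Finset.univ :=
    Submodule.finrank_mono (rowSpan_closureGraph_le G p)
  have h4 : (d + 1) * Fintype.card V = (d + 1) * K.card + (d + 1) * (Kᶜ).card := by
    rw [← mul_add, Finset.card_add_card_compl]
  omega

/-- The dichotomy is whether some neighbourhood in the closure graph is a clique. The bound `hkd`
says `|S| (8 D + 1) < n` for the dominating set `S`, which makes the second alternative contradict
the universal rank bound. -/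
theorem isRigid_of_forall_le_degree (hδ : ∀ v, Fintype.card V + 2 * d ≤ 2 * G.degree v)
    [Nonempty V] {k : ℕ} (hk : 2 ^ k * Fintype.card V < 3 ^ k)
    (hkd : ((d + 2) * k) * (8 * (d + 1) + 1) < Fintype.card V) : G.IsRigid (d + 1) := by
  classical
  obtain ⟨p, hp⟩ := exists_isGeneric (V := V) (D := d + 1)
  have hV : d + 1 + 1 ≤ Fintype.card V := by
    obtain ⟨v⟩ := ‹Nonempty V›
    have h1 := hδ v
    have h2 := G.degree_lt_card_verts v
    omega
  refine isRigid_of_le_indRank G hp hV ?_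
  by_cases hclique : ∃ v, ∀ x y, x ≠ y → (closureGraph G p).Adj v x → (closureGraph G p).Adj v y →
      (closureGraph G p).Adj x y
  · obtain ⟨v, hv⟩ := hclique
    refine le_indRank_of_isClique G hδ hp (K := (closureGraph G p).neighborFinset v) ?_ ?_
    · intro x hx y hy hxy
      exact hv x y hxy (by simpa using hx) (by simpa using hy)
    · have h1 : G.neighborFinset v ⊆ (closureGraph G p).neighborFinset v := fun u hu => by
        rw [SimpleGraph.mem_neighborFinset] at hu ⊢
        exact le_closureGraph G p hu
      have h2 := Finset.card_le_card h1
      rw [SimpleGraph.card_neighborFinset_eq_degree] at h2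
      have := hδ v
      omega
  · exfalso
    push Not at hclique
    have h6 : 6 * ((d + 2) * k) ≤ Fintype.card V := by
      have : (d + 2) * k * 6 ≤ (d + 2) * k * (8 * (d + 1) + 1) :=
        Nat.mul_le_mul_left _ (by omega)
      omega
    -- Here `d + 2` is `D + 1`, the number of neighbours needed for the larger rank gain.
    obtain ⟨S, hSc, hS⟩ := exists_card_le_forall_le_card_filter_adj G
      (fun v => (Nat.le_add_right _ _).trans (hδ v)) hk (d + 2) h6
    have h1 := succ_mul_card_compl_le_indRank (closureGraph G p) hp S
      (fun v => (hS v).trans (Finset.card_le_card fun u hu => by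
        rw [Finset.mem_filter] at hu ⊢
        exact ⟨hu.1, le_closureGraph G p hu.2⟩))
      (fun v => by
        obtain ⟨x, y, hxy, hx, hy, hn⟩ := hclique v
        exact ⟨x, y, hxy, hx, hy, fun hmem => hn ⟨hxy, rowSpan_closureGraph_le G p hmem⟩⟩)
    have h2 := rank_rigidityMatrix_add_le (closureGraph G p) hp hV
    rw [rank_rigidityMatrix] at h2
    have h3 := Finset.card_add_card_compl S
    have h4 : S.card * (8 * (d + 1) + 1) ≤ (d + 2) * k * (8 * (d + 1) + 1) :=
      Nat.mul_le_mul_right _ hSc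
    have h5 : (d + 1) * Fintype.card V = (d + 1) * S.card + (d + 1) * (Sᶜ).card := by
      rw [← mul_add, h3]
    have h7 : S.card * (8 * (d + 1) + 1) = 8 * ((d + 1) * S.card) + S.card := by ring
    omega

/-- Take `k = ⌊3 log n⌋ + 1`. Since `log (3/2) ≥ 1/3`, this gives `(3/2)^k > n`. -/
theorem exists_two_pow_mul_lt_three_pow {n d : ℕ} (hn : 2 ≤ n) (hd : 1 ≤ d)
    (h : (d : ℝ) < 1 / 100 * Real.sqrt n / Real.log n) :
    ∃ k, 2 ^ k * n < 3 ^ k ∧ ((d + 2) * k) * (8 * (d + 1) + 1) < n := by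
  have hn' : (2 : ℝ) ≤ n := by exact_mod_cast hn
  have hd' : (1 : ℝ) ≤ d := by exact_mod_cast hd
  set l := Real.log n with hl
  have hl2 : 2 / 3 < l := by
    have h1 : Real.log 2 ≤ l := Real.log_le_log (by norm_num) hn'
    have := Real.log_two_gt_d9
    linarith
  have hk1 : 3 * l < (⌊3 * l⌋₊ + 1 : ℕ) := by
    push_cast; exact Nat.lt_floor_add_one _
  have hk2 : ((⌊3 * l⌋₊ + 1 : ℕ) : ℝ) ≤ 5 * l := by
    have := Nat.floor_le (a := 3 * l) (by linarith)
    push_cast; linarith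
  generalize ⌊3 * l⌋₊ + 1 = k at hk1 hk2
  refine ⟨k, ?_, ?_⟩
  · have hlog : (1 : ℝ) / 3 ≤ Real.log (3 / 2) := by
      have := Real.one_sub_inv_le_log_of_pos (x := 3 / 2) (by norm_num)
      norm_num at this ⊢
      linarith
    have h1 : l < Real.log ((3 / 2) ^ k) := by
      rw [Real.log_pow]
      have : (k : ℝ) * (1 / 3) ≤ k * Real.log (3 / 2) := by gcongr
      linarith
    have h2 : (n : ℝ) < (3 / 2) ^ k := (Real.log_lt_log_iff (by linarith) (by positivity)).1 h1
    rw [div_pow, lt_div_iff₀ (by positivity)] at h2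
    have : (2 : ℝ) ^ k * n < 3 ^ k := by linarith
    exact_mod_cast this
  · have hdl : d * l < 1 / 100 * Real.sqrt n := by
      rwa [lt_div_iff₀ (by linarith)] at h
    have hsq : (d * l) ^ 2 < 1 / 10000 * n := by
      have h1 : (d * l) ^ 2 < (1 / 100 * Real.sqrt n) ^ 2 :=
        pow_lt_pow_left₀ hdl (by positivity) two_ne_zero
      rw [mul_pow (1 / 100), Real.sq_sqrt (by linarith)] at h1
      linarith
    -- The product is at most `255 d² l`, and `1 ≤ (3/2) l` turns this into at most `382.5 (d l)²`,
    -- well below `n` because `(d l)² < n / 10000`.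
    have h2 : ((d : ℝ) + 2) * k * (8 * (d + 1) + 1) ≤ (3 * d) * (5 * l) * (17 * d) := by
      gcongr <;> linarith
    have h3 : (d : ℝ) ^ 2 * l * 1 ≤ d ^ 2 * l * (3 / 2 * l) := by
      gcongr; linarith
    have : ((d : ℝ) + 2) * k * (8 * (d + 1) + 1) < n := by nlinarith
    exact_mod_cast this

end MinDegree

end RigidityRow

theorem theorem1p12 :
    ∃ c : ℝ, 0 < c ∧
      ∀ (V : Type*) [Fintype V] (G : SimpleGraph V) [DecidableRel G.Adj] (n d : ℕ),
        Fintype.card V = n → 2 ≤ n →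
        (d : ℝ) < c * Real.sqrt n / Real.log n →
        (n : ℝ) / 2 + d ≤ G.minDegree →
        G.IsRigid (d + 1) := by
  refine ⟨1 / 100, by norm_num, ?_⟩
  intro V _ G _ n d hV hn hd hmin
  classical
  subst hV
  have : Nonempty V := Fintype.card_pos_iff.1 (by omega)
  have hδ : ∀ v, Fintype.card V + 2 * d ≤ 2 * G.degree v := by
    intro v
    have h1 : (G.minDegree : ℝ) ≤ G.degree v := by exact_mod_cast G.minDegree_le_degree v
    have h2 : (Fintype.card V : ℝ) + 2 * d ≤ 2 * G.degree v := by linarith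
    exact_mod_cast h2
  rcases Nat.eq_zero_or_pos d with rfl | hpos
  · exact RigidityRow.isRigid_one G (by simpa using hδ) hn
  · obtain ⟨k, hk, hkd⟩ := RigidityRow.exists_two_pow_mul_lt_three_pow hn hpos hd
    exact RigidityRow.isRigid_of_forall_le_degree G hδ hk hkd
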